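/- Let $p\ge 3$ be an integer and let $\mathfrak G$ be the $p$-adic Vilenkin group: the group of all sequences $x=(x_n)_{n\in\mathbb Z}$, $x_n\in\mathbb Z/p\mathbb Z$, having only finitely many nonzero terms with negative index, with coordinate-wise addition modulo $p$. Let $\mathfrak G_n=\{x: x_k=0 \text{ for } k<n\}$; the cosets of the subgroups $\mathfrak G_n$ ($n\in\mathbb Z$) form a base of the topology. Let $\mu$ be the Haar measure with $\mu(\mathfrak G_0)=1$, let $X$ be the group of (continuous unitary) characters of $\mathfrak G$, and let $\mathfrak G_n^\perp=\{\chi\in X:\chi=1\text{ on }\mathfrak G_n\}$. Let $\mathcal A$ be the dilation $(\mathcal A x)_n=x_{n+1}$, and $(\chi\mathcal A^{j})(x)=\chi(\mathcal A^{j}x)$ for $\chi\in X$, $j\in\mathbb Z$. Let $H_0=\{h\in\mathfrak G: h_n=0 \text{ for } n\ge 0\}$ and, for $s\in\mathbb N$, $H_0^{(s)}=H_0\cap\mathfrak G_{-s}$. For $M,N\in\mathbb N$ let $\mathfrak D_M(\mathfrak G_{-N})$ be the set of functions $\varphi:\mathfrak G\to\mathbb C$ that vanish outside $\mathfrak G_{-N}$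 and are constant on the cosets of $\mathfrak G_M$, and let $\hat\varphi(\chi)=\int_{\mathfrak G}\varphi(x)\overline{\chi(x)}\,d\mu(x)$. A function $\varphi\in\mathfrak D_M(\mathfrak G_{-N})$ is called a $1$-elementary refinable function if there are $\beta_h\in\mathbb C$ ($h\in H_0^{(N+1)}$) with $$\varphi(x)=\sum_{h\in H_0^{(N+1)}}\beta_h\,\varphi(\mathcal A x-h)\qquad(x\in\mathfrak G)$$ such that the mask $m_0(\chi)=\frac1p\sum_{h\in H_0^{(N+1)}}\beta_h\overline{(\chi\mathcal A^{-1})(h)}$ is constant on the cosets of $\mathfrak G_{-1}^\perp$, its modulus $|m_0|$ takes no values other than $0$ and $1$, and $\hat\varphi(\chi)=\prod_{j=0}^\infty m_0(\chi\mathcal A^{-j})$ for all $\chi\in X$ (the product being the limit of its partial products). A family $(V_n)_{n\in\mathbb Z}$ of closed subspaces of $L_2(\mathfrak G)$ is a multiresolution analysis (MRA) if (A1) $V_n\subset V_{n+1}$; (A2) $\overline{\bigcup_n V_n}=L_2(\mathfrak G)$ and $\bigcap_n V_n=\{0\}$; (A3) $f(x)\in V_n\iff f(\mathcal A x)\in V_{n+1}$;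 (A4) $f\in V_0$ implies $f(\cdot-h)\in V_0$ for all $h\in H_0$; (A5) for some $\psi\in L_2(\mathfrak G)$ the system $(\psi(\cdot-h))_{h\in H_0}$ is an orthonormal basis of $V_0$. A function $\varphi\in L_2(\mathfrak G)$ generates an orthogonal MRA if $(\varphi(\cdot-h))_{h\in H_0}$ is an orthonormal system and the closed linear spans $V_j$ of $\{\varphi(\mathcal A^{j}x-h):h\in H_0\}$, $j\in\mathbb Z$, form an MRA. Then for all $M,N\in\mathbb N$: if $\varphi\in\mathfrak D_M(\mathfrak G_{-N})$ is a $1$-elementary refinable function that generates an orthogonal MRA on $\mathfrak G$, then $\operatorname{supp}\hat\varphi\subset\mathfrak G_{p-2}^\perp$. -/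

import Mathlib

/-- The `p`-adic Vilenkin group: all two-sided sequences `x = (x_n)` with entries in `ℤ/p` that
have only finitely many nonzero terms with negative index. -/
structure VilenkinGroup (p : ℕ) : Type where
  coeff : ℤ → ZMod p
  exists_lower : ∃ m : ℤ, ∀ n < m, coeff n = 0

namespace VilenkinGroup

open scoped ENNReal ComplexConjugate Topology

instance (p : ℕ) : CoeFun (VilenkinGroup p) (fun _ => ℤ → ZMod p) := ⟨coeff⟩

variable {p : ℕ}

@[ext] theorem ext {x y : VilenkinGroup p} (h : ∀ n, x n = y n) : x = y := by
  cases x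
  cases y
  congr
  exact funext h

instance (p : ℕ) : Zero (VilenkinGroup p) := ⟨⟨fun _ => 0, 0, fun _ _ => rfl⟩⟩

instance (p : ℕ) : Add (VilenkinGroup p) :=
  ⟨fun x y => ⟨fun n => x n + y n, by
    obtain ⟨a, ha⟩ := x.exists_lower
    obtain ⟨b, hb⟩ := y.exists_lower
    refine ⟨min a b, fun n hn => ?_⟩
    rw [ha n (lt_of_lt_of_le hn (min_le_left _ _)),
      hb n (lt_of_lt_of_le hn (min_le_right _ _)), add_zero]⟩⟩

instance (p : ℕ) : Neg (VilenkinGroup p) :=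
  ⟨fun x => ⟨fun n => -x n, by
    obtain ⟨a, ha⟩ := x.exists_lower
    exact ⟨a, fun n hn => by rw [ha n hn, neg_zero]⟩⟩⟩

@[simp] theorem zero_apply (n : ℤ) : (0 : VilenkinGroup p) n = 0 := rfl

@[simp] theorem add_apply (x y : VilenkinGroup p) (n : ℤ) : (x + y) n = x n + y n := rfl

@[simp] theorem neg_apply (x : VilenkinGroup p) (n : ℤ) : (-x) n = -x n := rfl

/-- The group operation is coordinate-wise addition modulo `p`. -/
instance (p : ℕ) : AddCommGroup (VilenkinGroup p) where
  add_assoc _ _ _ := ext fun _ => add_assoc _ _ _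
  zero_add _ := ext fun _ => zero_add _
  add_zero _ := ext fun _ => add_zero _
  add_comm _ _ := ext fun _ => add_comm _ _
  neg_add_cancel _ := ext fun _ => neg_add_cancel _
  nsmul := nsmulRec
  zsmul := zsmulRec

@[simp] theorem sub_apply (x y : VilenkinGroup p) (n : ℤ) : (x - y) n = x n - y n :=
  (sub_eq_add_neg (x n) (y n)).symm

/-- The basic chain: `ball p n` is the subgroup `G_n` of all `x` with `x_k = 0` for `k < n`. -/
def ball (p : ℕ) (n : ℤ) : AddSubgroup (VilenkinGroup p) where
  carrier := {x | ∀ k < n, x k = 0}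
  zero_mem' := fun _ _ => rfl
  add_mem' := by
    intro x y hx hy k hk
    rw [add_apply, hx k hk, hy k hk, add_zero]
  neg_mem' := by
    intro x hx k hk
    rw [neg_apply, hx k hk, neg_zero]

theorem mem_ball {n : ℤ} {x : VilenkinGroup p} : x ∈ ball p n ↔ ∀ k < n, x k = 0 := Iff.rfl

theorem ball_anti {m n : ℤ} (h : m ≤ n) : ball p n ≤ ball p m :=
  fun _ hx k hk => hx k (lt_of_lt_of_le hk h)

/-- The topology generated by the chain: the cosets `x + G_n` form a base, so a set is open iff
with each point it contains one of the cosets of that point. -/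
instance (p : ℕ) : TopologicalSpace (VilenkinGroup p) where
  IsOpen U := ∀ x ∈ U, ∃ n : ℤ, ∀ y, y - x ∈ ball p n → y ∈ U
  isOpen_univ := fun _ _ => ⟨0, fun _ _ => trivial⟩
  isOpen_inter := by
    rintro U V hU hV x ⟨hxU, hxV⟩
    obtain ⟨a, ha⟩ := hU x hxU
    obtain ⟨b, hb⟩ := hV x hxV
    exact ⟨max a b, fun y hy => ⟨ha y (ball_anti (le_max_left _ _) hy),
      hb y (ball_anti (le_max_right _ _) hy)⟩⟩
  isOpen_sUnion := by
    rintro S hS x ⟨U, hU, hxU⟩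
    obtain ⟨n, hn⟩ := hS U hU x hxU
    exact ⟨n, fun y hy => ⟨U, hU, hn y hy⟩⟩

theorem isOpen_iff {U : Set (VilenkinGroup p)} :
    IsOpen U ↔ ∀ x ∈ U, ∃ n : ℤ, ∀ y, y - x ∈ ball p n → y ∈ U := Iff.rfl

theorem isOpen_coset (x : VilenkinGroup p) (n : ℤ) : IsOpen {y | y - x ∈ ball p n} := by
  intro y hy
  refine ⟨n, fun z hz => ?_⟩
  have h := (ball p n).add_mem hz hy
  simpa using h

theorem hasBasis_nhds (x : VilenkinGroup p) :
    (𝓝 x).HasBasis (fun _ : ℤ => True) (fun n => {y | y - x ∈ ball p n}) := by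
  refine ⟨fun s => ⟨fun hs => ?_, ?_⟩⟩
  · obtain ⟨U, hUs, hU, hxU⟩ := mem_nhds_iff.1 hs
    obtain ⟨n, hn⟩ := hU x hxU
    exact ⟨n, trivial, fun y hy => hUs (hn y hy)⟩
  · rintro ⟨n, -, hn⟩
    exact mem_nhds_iff.2 ⟨_, hn, isOpen_coset x n, by simp [(ball p n).zero_mem]⟩

instance (p : ℕ) : IsTopologicalAddGroup (VilenkinGroup p) where
  continuous_add := by
    rw [continuous_iff_continuousAt]
    rintro ⟨x, y⟩
    refine (((hasBasis_nhds x).prod_nhds (hasBasis_nhds y)).tendsto_iff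
      (hasBasis_nhds (x + y))).2 fun n _ => ⟨(n, n), ⟨trivial, trivial⟩, ?_⟩
    rintro ⟨a, b⟩ ⟨ha, hb⟩
    have h := (ball p n).add_mem ha hb
    have e : a + b - (x + y) = a - x + (b - y) := by abel
    simpa [e] using h
  continuous_neg := by
    rw [continuous_iff_continuousAt]
    intro x
    refine ((hasBasis_nhds x).tendsto_iff (hasBasis_nhds (-x))).2 fun n _ => ⟨n, trivial, ?_⟩
    intro a ha
    have h := (ball p n).neg_mem ha
    have e : -a - -x = -(a - x) := by abel
    rw [Set.mem_ofPred_eq, e]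
    exact h

theorem isOpen_ball (n : ℤ) : IsOpen (ball p n : Set (VilenkinGroup p)) := by
  have h := isOpen_coset (0 : VilenkinGroup p) n
  simpa using h

theorem isCompact_ball [NeZero p] (n : ℤ) : IsCompact (ball p n : Set (VilenkinGroup p)) := by
  classical
  let F : (ℤ → ZMod p) → VilenkinGroup p := fun a =>
    ⟨fun k => if k < n then 0 else a k, n, fun k hk => if_pos hk⟩
  have hF : Continuous F := by
    rw [continuous_iff_continuousAt]
    intro a
    refine (hasBasis_nhds (F a)).tendsto_right_iff.2 fun m _ => ?_
    have hfin : (Set.Ico n m).Finite := Set.finite_Ico n m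
    have hev : ∀ᶠ b in 𝓝 a, ∀ k ∈ Set.Ico n m, b k = a k := by
      refine (Filter.eventually_all_finite hfin).2 fun k _ => ?_
      exact (continuous_apply k).continuousAt.eventually
        ((isOpen_discrete ({a k} : Set (ZMod p))).mem_nhds rfl)
    filter_upwards [hev] with b hb k hk
    rw [sub_apply]
    change (if k < n then 0 else b k) - (if k < n then 0 else a k) = 0
    split_ifs with h
    · simp
    · rw [hb k ⟨not_lt.1 h, hk⟩, sub_self]
  have hr : Set.range F = (ball p n : Set (VilenkinGroup p)) := by
    ext x
    constructor
    · rintro ⟨a, rfl⟩ k hk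
      exact if_pos hk
    · intro hx
      refine ⟨x, ?_⟩
      ext k
      change (if k < n then 0 else x k) = x k
      split_ifs with h
      · exact (hx k h).symm
      · rfl
  rw [← hr]
  exact isCompact_range hF

instance (p : ℕ) : MeasurableSpace (VilenkinGroup p) := borel _

instance (p : ℕ) : BorelSpace (VilenkinGroup p) := ⟨rfl⟩

/-- The compact open subgroup `G_0`. -/
def unitBall (p : ℕ) [NeZero p] : TopologicalSpace.PositiveCompacts (VilenkinGroup p) where
  carrier := ball p 0
  isCompact' := isCompact_ball 0
  interior_nonempty' := by
    rw [(isOpen_ball (p := p) 0).interior_eq]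
    exact ⟨0, (ball p 0).zero_mem⟩

/-- The Haar measure `μ`, normalized by `μ(G_0) = 1`. -/
noncomputable def haar (p : ℕ) [NeZero p] : MeasureTheory.Measure (VilenkinGroup p) :=
  MeasureTheory.Measure.addHaarMeasure (unitBall p)

/-- The `j`-th power `A^j` of the dilation operator: `(A^j x)_n = x_{n+j}`, so that
`A (∑ a_n g_n) = ∑ a_n g_{n-1}`, where `g_n` is the sequence with a `1` in place `n` and
`0` elsewhere. -/
def dil (p : ℕ) (j : ℤ) : VilenkinGroup p ≃ₜ+ VilenkinGroup p where
  toFun x := ⟨fun n => x (n + j), by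
    obtain ⟨m, hm⟩ := x.exists_lower
    exact ⟨m - j, fun n hn => hm _ (by omega)⟩⟩
  invFun x := ⟨fun n => x (n - j), by
    obtain ⟨m, hm⟩ := x.exists_lower
    exact ⟨m + j, fun n hn => hm _ (by omega)⟩⟩
  left_inv x := by
    ext n
    change x (n - j + j) = x n
    rw [sub_add_cancel]
  right_inv x := by
    ext n
    change x (n + j - j) = x n
    rw [add_sub_cancel_right]
  map_add' _ _ := rfl
  continuous_toFun := by
    refine continuous_iff_continuousAt.2 fun x => ?_
    refine ((hasBasis_nhds x).tendsto_iff (hasBasis_nhds _)).2 fun n _ => ⟨n + j, trivial, ?_⟩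
    intro y hy k hk
    exact hy (k + j) (by omega)
  continuous_invFun := by
    refine continuous_iff_continuousAt.2 fun x => ?_
    refine ((hasBasis_nhds x).tendsto_iff (hasBasis_nhds _)).2 fun n _ => ⟨n - j, trivial, ?_⟩
    intro y hy k hk
    exact hy (k - j) (by omega)

@[simp] theorem dil_apply (j : ℤ) (x : VilenkinGroup p) (n : ℤ) : dil p j x n = x (n + j) := rfl

theorem dil_zero (x : VilenkinGroup p) : dil p 0 x = x := by
  ext n
  simp

theorem dil_add (i j : ℤ) (x : VilenkinGroup p) : dil p (i + j) x = dil p i (dil p j x) := by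
  ext n
  simp [add_assoc]

/-- The set `H_0` of all finite sums `a_{-1} g_{-1} + ... + a_{-s} g_{-s}`. -/
def H₀ (p : ℕ) : AddSubgroup (VilenkinGroup p) where
  carrier := {h | ∀ n : ℤ, 0 ≤ n → h n = 0}
  zero_mem' := fun _ _ => rfl
  add_mem' := by
    intro x y hx hy k hk
    rw [add_apply, hx k hk, hy k hk, add_zero]
  neg_mem' := by
    intro x hx k hk
    rw [neg_apply, hx k hk, neg_zero]

theorem finite_trunc (p : ℕ) [NeZero p] (s : ℕ) :
    {h : VilenkinGroup p | h ∈ H₀ p ∧ h ∈ ball p (-(s : ℤ))}.Finite := by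
  classical
  let r : VilenkinGroup p → (Fin s → ZMod p) := fun h i => h (-(i : ℤ) - 1)
  refine Set.Finite.of_finite_image (f := r) (Set.toFinite _) ?_
  rintro x ⟨hx0, hxs⟩ y ⟨hy0, hys⟩ hxy
  ext n
  rcases le_or_gt 0 n with hn | hn
  · rw [hx0 n hn, hy0 n hn]
  · rcases lt_or_ge n (-(s : ℤ)) with hs | hs
    · rw [hxs n hs, hys n hs]
    · have h := congrFun hxy (⟨(-n - 1).toNat, by omega⟩ : Fin s)
      have e : -(((-n - 1).toNat : ℕ) : ℤ) - 1 = n := by omega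
      simpa only [r, e] using h

/-- The finite set `H_0^{(s)}` of all sums `a_{-1} g_{-1} + ... + a_{-s} g_{-s}`. -/
noncomputable def H₀trunc (p : ℕ) [NeZero p] (s : ℕ) : Finset (VilenkinGroup p) :=
  (finite_trunc p s).toFinset

/-- The group `X` of characters of the Vilenkin group (its Pontryagin dual). -/
abbrev Dual (p : ℕ) : Type := PontryaginDual (Multiplicative (VilenkinGroup p))

/-- The value `(χ, x)` of a character at a point. -/
noncomputable def pair (χ : Dual p) (x : VilenkinGroup p) : ℂ := (χ (Multiplicative.ofAdd x) : ℂ)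

/-- The annihilator `G_n^⊥` of `G_n`. -/
def annihilator (p : ℕ) (n : ℤ) : Subgroup (Dual p) where
  carrier := {χ | ∀ x ∈ ball p n, χ (Multiplicative.ofAdd x) = 1}
  one_mem' := fun _ _ => rfl
  mul_mem' := by
    intro χ ψ hχ hψ x hx
    change χ _ * ψ _ = 1
    rw [hχ x hx, hψ x hx, one_mul]
  inv_mem' := by
    intro χ hχ x hx
    change (χ _)⁻¹ = 1
    rw [hχ x hx, inv_one]

/-- The character `χ A^j`, defined by `(χ A^j, x) = (χ, A^j x)`. -/
noncomputable def dualDil (j : ℤ) (χ : Dual p) : Dual p where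
  toFun x := χ (Multiplicative.ofAdd (dil p j x.toAdd))
  map_one' := by
    rw [toAdd_one, map_zero, ofAdd_zero, map_one]
  map_mul' x y := by
    rw [toAdd_mul, map_add, ofAdd_add, map_mul]
  continuous_toFun := (map_continuous χ).comp
    (continuous_ofAdd.comp ((dil p j).continuous_toFun.comp continuous_toAdd))

/-- The Fourier transform. It is applied only to compactly supported step functions, which are
integrable, so that the integral is the Fourier transform in every sense. -/
noncomputable def fourier [NeZero p] (f : VilenkinGroup p → ℂ) (χ : Dual p) : ℂ :=
  ∫ x, f x * conj (pair χ x) ∂(haar p)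

/-- The class `D_M(G_{-N})` of step functions that vanish outside `G_{-N}` and are constant on the
cosets of `G_M`. Such functions have finitely many values and lie in every `L_q`. -/
structure IsStep (M N : ℕ) (f : VilenkinGroup p → ℂ) : Prop where
  support_subset : Function.support f ⊆ ball p (-(N : ℤ))
  const_on_cosets : ∀ x y, x - y ∈ ball p (M : ℤ) → f x = f y

/-- The Hilbert space `L_2(G)`. -/
abbrev L2 (p : ℕ) [NeZero p] : Type := MeasureTheory.Lp ℂ 2 (haar p)

/-- `φ` is in `L_2(G)` and its shifts `φ(x - h)`, `h ∈ H_0`, form an orthonormal system. -/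
def OrthonormalShifts [NeZero p] (φ : VilenkinGroup p → ℂ) : Prop :=
  MeasureTheory.MemLp φ 2 (haar p) ∧
    ∀ h ∈ H₀ p, ∀ h' ∈ H₀ p,
      (h = h' → ∫ x, φ (x - h) * conj (φ (x - h')) ∂(haar p) = 1) ∧
      (h ≠ h' → ∫ x, φ (x - h) * conj (φ (x - h')) ∂(haar p) = 0)

/-- The closed linear span in `L_2(G)` of the functions `φ(A^j x - h)`, `h ∈ H_0`. -/
noncomputable def scaleSpace [NeZero p] (φ : VilenkinGroup p → ℂ) (j : ℤ) :
    Submodule ℂ (L2 p) :=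
  (Submodule.span ℂ {f : L2 p | ∃ h ∈ H₀ p,
    f =ᵐ[haar p] fun x => φ (dil p j x - h)}).topologicalClosure

/-- Multiresolution analyses of `L_2(G)`. -/
structure IsMRA [NeZero p] (V : ℤ → Submodule ℂ (L2 p)) : Prop where
  isClosed : ∀ n, IsClosed (V n : Set (L2 p))
  mono : ∀ n, V n ≤ V (n + 1)
  dense : closure (⋃ n, (V n : Set (L2 p))) = Set.univ
  separated : ⋂ n, (V n : Set (L2 p)) = {0}
  dilation : ∀ n, ∀ f g : L2 p, (g =ᵐ[haar p] fun x => f (dil p 1 x)) →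
    (f ∈ V n ↔ g ∈ V (n + 1))
  shift : ∀ f ∈ V 0, ∀ h ∈ H₀ p, ∀ g : L2 p, (g =ᵐ[haar p] fun x => f (x - h)) → g ∈ V 0
  scaling : ∃ φ : VilenkinGroup p → ℂ, OrthonormalShifts φ ∧ V 0 = scaleSpace φ 0

/-- `φ` generates an orthogonal MRA: its shifts are orthonormal and the closed spans `V_j` of the
functions `φ(A^j x - h)`, `h ∈ H_0`, form an MRA. -/
def GeneratesMRA [NeZero p] (φ : VilenkinGroup p → ℂ) : Prop :=
  OrthonormalShifts φ ∧ IsMRA (scaleSpace φ)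

/-- `φ` solves the refinement equation `φ(x) = ∑ β_h φ(A x - h)`, `h ∈ H_0^{(N+1)}`, and `m₀` is
the mask `m₀(χ) = (1/p) ∑ β_h conj (χ A⁻¹, h)` of this equation. For `φ` in `D_M(G_{-N})` the
refinement equation has this finite form. -/
def IsRefinableWithMask [NeZero p] (N : ℕ) (φ : VilenkinGroup p → ℂ) (m₀ : Dual p → ℂ) : Prop :=
  ∃ β : VilenkinGroup p → ℂ,
    (∀ x, φ x = ∑ h ∈ H₀trunc p (N + 1), β h * φ (dil p 1 x - h)) ∧
    ∀ χ, m₀ χ = (1 / (p : ℂ)) * ∑ h ∈ H₀trunc p (N + 1), β h * conj (pair (dualDil (-1) χ) h)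

/-- A function on the dual group is `K`-elementary if it is constant on the cosets of `G_{-K}^⊥`
and its modulus takes no values other than `0` and `1`. -/
structure IsElementary (K : ℕ) (m₀ : Dual p → ℂ) : Prop where
  const_on_cosets : ∀ χ ψ, χ / ψ ∈ annihilator p (-(K : ℤ)) → m₀ χ = m₀ ψ
  norm_eq : ∀ χ, ‖m₀ χ‖ = 0 ∨ ‖m₀ χ‖ = 1

/-- `φ` (a function in some `D_M(G_{-N})`) is a `K`-elementary refinable function: it is refinable
with a `K`-elementary mask `m₀`, and `φ̂(χ)` is the infinite product of `m₀(χ A^{-j})`, `j ≥ 0`. -/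
def IsElementaryRefinable [NeZero p] (K N : ℕ) (φ : VilenkinGroup p → ℂ) : Prop :=
  ∃ m₀ : Dual p → ℂ, IsRefinableWithMask N φ m₀ ∧ IsElementary K m₀ ∧
    ∀ χ, Filter.Tendsto (fun n : ℕ => ∏ j ∈ Finset.range n, m₀ (dualDil (-(j : ℤ)) χ))
      Filter.atTop (𝓝 (fourier φ χ))

end VilenkinGroup

namespace VilenkinGroup

open scoped ENNReal ComplexConjugate Topology
open MeasureTheory Filter

variable {p : ℕ}

/-! ### Characters and annihilators -/

section Characters

/-! A character `χ` has coordinates `pair χ (unit p k)`, which are `p`-th roots of unity. A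
1-elementary mask sees only the places `-1` and `0` (`mask_congr`), so the product for `φ̂(χ)` runs
over the consecutive coordinate pairs at places `j - 1, j` with `j ≥ 0`: it is the weight of a walk
on the `p` roots of unity. If `φ̂(χ) ≠ 0`, the walk is eventually constantly `1`, because `φ` is a
step function, and every tail of it has weight of modulus `1`.

Suppose that the walk repeats a vertex before settling at `1`. The tails from the two occurrences
give two characters that agree on `H₀`, differ on `G_{-N}`, and have `|φ̂| = 1`. Orthonormality of
the shifts bounds the sum of `|φ̂|²` over characters with a common restriction to `H₀` by `1`, so
this is impossible (`OrthonormalShifts.pair_eq_of_norm_fourier_eq_one`). Hence the vertices at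
places `-1, ..., l` are distinct, where `l` is the first natural number with `χ` trivial on `G_l`
(`pair_unit_ne_of_lt`). Since there are `l + 2` of them, `l ≤ p - 2`. -/

theorem pair_add (χ : Dual p) (x y : VilenkinGroup p) :
    pair χ (x + y) = pair χ x * pair χ y := by
  simp [pair, ofAdd_add]

theorem pair_zero (χ : Dual p) : pair χ 0 = 1 := by
  simp [pair]

theorem norm_pair (χ : Dual p) (x : VilenkinGroup p) : ‖pair χ x‖ = 1 :=
  Circle.norm_coe _

theorem pair_mul_conj (χ : Dual p) (x : VilenkinGroup p) : pair χ x * conj (pair χ x) = 1 := by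
  rw [Complex.mul_conj']
  simp [norm_pair]

theorem pair_nsmul (χ : Dual p) (n : ℕ) (x : VilenkinGroup p) :
    pair χ (n • x) = pair χ x ^ n := by
  simp [pair, ofAdd_nsmul]

theorem continuous_pair (χ : Dual p) : Continuous (pair χ) :=
  continuous_subtype_val.comp ((map_continuous χ).comp continuous_ofAdd)

theorem dual_ext {χ ψ : Dual p} (h : ∀ x, pair χ x = pair ψ x) : χ = ψ :=
  DFunLike.ext _ _ fun x => Circle.coe_injective (h x.toAdd)

theorem pair_dual_mul (χ ψ : Dual p) (x : VilenkinGroup p) :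
    pair (χ * ψ) x = pair χ x * pair ψ x :=
  Circle.coe_mul _ _

theorem pair_dual_div (χ ψ : Dual p) (x : VilenkinGroup p) :
    pair (χ / ψ) x = pair χ x / pair ψ x := by
  rw [div_eq_mul_inv, pair_dual_mul, div_eq_mul_inv]
  congr 1

theorem mem_annihilator_iff {n : ℤ} {χ : Dual p} :
    χ ∈ annihilator p n ↔ ∀ x ∈ ball p n, pair χ x = 1 :=
  forall₂_congr fun _ _ => Circle.coe_eq_one.symm

theorem annihilator_mono {m n : ℤ} (h : m ≤ n) : annihilator p m ≤ annihilator p n :=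
  fun _ hχ x hx => hχ x (ball_anti h hx)

theorem continuous_dual_eval (x : Multiplicative (VilenkinGroup p)) :
    Continuous fun χ : Dual p => χ x :=
  (continuous_eval_const (F := C(Multiplicative (VilenkinGroup p), Circle)) x).comp
    (ContinuousMonoidHom.isInducing_toContinuousMap _ _).continuous

/-- Lets the bound, proved where `φ̂ ≠ 0`, pass to the closed support. -/
theorem isClosed_annihilator (n : ℤ) : IsClosed (annihilator p n : Set (Dual p)) := by
  have h : (annihilator p n : Set (Dual p)) =
      ⋂ x ∈ ball p n, {χ : Dual p | χ (Multiplicative.ofAdd x) = 1} := by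
    ext χ
    simp only [Set.mem_iInter]
    rfl
  rw [h]
  exact isClosed_biInter fun x _ => isClosed_eq (continuous_dual_eval _) continuous_const

/-- The composition of a character with a continuous endomorphism. -/
noncomputable def dualComp (f : VilenkinGroup p →+ VilenkinGroup p) (hf : Continuous f)
    (χ : Dual p) : Dual p where
  toFun x := χ (Multiplicative.ofAdd (f x.toAdd))
  map_one' := by rw [toAdd_one, map_zero, ofAdd_zero, map_one]
  map_mul' x y := by rw [toAdd_mul, map_add, ofAdd_add, map_mul]
  continuous_toFun := (map_continuous χ).comp
    (continuous_ofAdd.comp (hf.comp continuous_toAdd))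

theorem pair_dualComp (f : VilenkinGroup p →+ VilenkinGroup p) (hf : Continuous f) (χ : Dual p)
    (x : VilenkinGroup p) : pair (dualComp f hf χ) x = pair χ (f x) := rfl

theorem pair_dualDil (j : ℤ) (χ : Dual p) (x : VilenkinGroup p) :
    pair (dualDil j χ) x = pair χ (dil p j x) := rfl

theorem dualDil_dualDil (i j : ℤ) (χ : Dual p) : dualDil i (dualDil j χ) = dualDil (j + i) χ :=
  dual_ext fun x => by simp only [pair_dualDil, dil_add]

end Characters

/-! ### Coordinates of elements and of characters -/

section Coordinates

/-- The sequence with a `1` in place `k` and `0` elsewhere. -/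
def unit (p : ℕ) (k : ℤ) : VilenkinGroup p where
  coeff n := if n = k then 1 else 0
  exists_lower := ⟨k, fun _ hn => if_neg hn.ne⟩

theorem unit_apply (k n : ℤ) : unit p k n = if n = k then 1 else 0 := rfl

theorem unit_mem_ball {k n : ℤ} (h : n ≤ k) : unit p k ∈ ball p n :=
  fun _ hm => if_neg (by omega)

theorem dil_unit (j k : ℤ) : dil p j (unit p k) = unit p (k - j) := by
  ext n
  simp [unit_apply, eq_sub_iff_add_eq]

theorem nsmul_apply (m : ℕ) (x : VilenkinGroup p) (n : ℤ) : (m • x) n = m • x n := by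
  induction m with
  | zero => simp
  | succ m ih => rw [succ_nsmul, add_apply, ih, succ_nsmul]

theorem nsmul_unit_apply [NeZero p] (a : ZMod p) (k n : ℤ) :
    (a.val • unit p k) n = if n = k then a else 0 := by
  rw [nsmul_apply, unit_apply]
  split_ifs <;> simp

theorem pair_pow_card (χ : Dual p) (x : VilenkinGroup p) : pair χ x ^ p = 1 := by
  have h : p • x = 0 := by
    ext n
    simp [nsmul_apply]
  rw [← pair_nsmul, h, pair_zero]

theorem sub_nsmul_unit_mem_ball [NeZero p] {n : ℤ} {x : VilenkinGroup p} (hx : x ∈ ball p n) :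
    x - (x n).val • unit p n ∈ ball p (n + 1) := by
  intro k hk
  rw [sub_apply, nsmul_unit_apply]
  split_ifs with h
  · rw [h, sub_self]
  · rw [hx k (by omega), sub_zero]

/-- `unit p n` generates `G_n` modulo `G_{n+1}`. So if `n + 1` is the least level at which `χ` is
trivial, its coordinate in place `n` is not `1`. -/
theorem mem_annihilator_of_succ [NeZero p] {n : ℤ} {χ : Dual p}
    (h : χ ∈ annihilator p (n + 1)) (hn : pair χ (unit p n) = 1) : χ ∈ annihilator p n := by
  rw [mem_annihilator_iff] at h ⊢
  intro x hx
  rw [← sub_add_cancel x ((x n).val • unit p n), pair_add,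
    h _ (sub_nsmul_unit_mem_ball hx), pair_nsmul, hn, one_pow, one_mul]

/-- The truncation of a sequence to the places `k ≥ a`. -/
def tail (p : ℕ) (a : ℤ) : VilenkinGroup p →+ VilenkinGroup p where
  toFun x := ⟨fun k => if k < a then 0 else x k, a, fun _ hk => if_pos hk⟩
  map_zero' := by
    ext k
    change (if k < a then 0 else 0) = (0 : ZMod p)
    simp
  map_add' x y := by
    ext k
    change (if k < a then 0 else x k + y k) =
      (if k < a then 0 else x k) + (if k < a then 0 else y k)
    split_ifs <;> simp

theorem tail_apply (a : ℤ) (x : VilenkinGroup p) (k : ℤ) :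
    tail p a x k = if k < a then 0 else x k := rfl

theorem continuous_tail (a : ℤ) : Continuous (tail p a) := by
  refine continuous_iff_continuousAt.2 fun x => ?_
  refine ((hasBasis_nhds x).tendsto_iff (hasBasis_nhds _)).2 fun n _ => ⟨n, trivial, ?_⟩
  intro y hy k hk
  rw [← map_sub, tail_apply, hy k hk, ite_self]

theorem tail_mem_ball (a : ℤ) (x : VilenkinGroup p) : tail p a x ∈ ball p a :=
  fun _ hk => if_pos hk

theorem tail_eq_self {a : ℤ} {x : VilenkinGroup p} (hx : x ∈ ball p a) : tail p a x = x := by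
  ext k
  rw [tail_apply]
  split_ifs with h
  · exact (hx k h).symm
  · rfl

theorem tail_eq_zero {a : ℤ} {x : VilenkinGroup p} (hx : ∀ k ≥ a, x k = 0) : tail p a x = 0 := by
  ext k
  rw [tail_apply]
  split_ifs with h
  · rfl
  · rw [hx k (not_lt.1 h), zero_apply]

instance : T2Space (VilenkinGroup p) := by
  refine ⟨fun x y hxy => ?_⟩
  obtain ⟨k, hk⟩ : ∃ k, x k ≠ y k := by
    by_contra! h
    exact hxy (ext h)
  refine ⟨_, _, isOpen_coset x (k + 1), isOpen_coset y (k + 1), ?_, ?_, ?_⟩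
  · simp [(ball p _).zero_mem]
  · simp [(ball p _).zero_mem]
  · refine Set.disjoint_left.2 fun z hz hz' => hk ?_
    have h₁ := hz k (by omega)
    have h₂ := hz' k (by omega)
    rw [sub_apply, sub_eq_zero] at h₁ h₂
    rw [← h₁, h₂]

end Coordinates

/-! ### Locality of the mask -/

section Mask

variable [NeZero p]

theorem mem_H₀trunc {s : ℕ} {h : VilenkinGroup p} :
    h ∈ H₀trunc p s ↔ h ∈ H₀ p ∧ h ∈ ball p (-(s : ℤ)) := by
  simp [H₀trunc]

/-- A `1`-elementary mask depends only on the coordinates of a character in places `-1` and `0`. -/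
theorem mask_congr {N : ℕ} {φ : VilenkinGroup p → ℂ} {m₀ : Dual p → ℂ}
    (hm : IsRefinableWithMask N φ m₀) (he : IsElementary 1 m₀) {χ ψ : Dual p}
    (h₁ : pair χ (unit p (-1)) = pair ψ (unit p (-1)))
    (h₀ : pair χ (unit p 0) = pair ψ (unit p 0)) : m₀ χ = m₀ ψ := by
  obtain ⟨β, -, hβ⟩ := hm
  have hθ : ∀ x ∈ ball p (-1), pair (χ / ψ) x = pair (χ / ψ) (tail p 1 x) := by
    intro x hx
    have hx' : x = tail p 1 x + (x 0).val • unit p 0 + (x (-1)).val • unit p (-1) := by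
      ext k
      rw [add_apply, add_apply, nsmul_unit_apply, nsmul_unit_apply, tail_apply]
      rcases lt_trichotomy k (-1) with hk | rfl | hk
      · rw [if_pos (by omega), if_neg (by omega), if_neg (by omega), hx k hk]
        simp
      · simp
      · rcases eq_or_ne k 0 with rfl | hk0
        · simp
        · rw [if_neg (by omega), if_neg hk0, if_neg (by omega)]
          simp
    have hne : ∀ k, pair ψ (unit p k) ≠ 0 := fun k => by
      rw [← norm_ne_zero_iff, norm_pair]
      exact one_ne_zero
    conv_lhs => rw [hx']
    simp [pair_add, pair_nsmul, pair_dual_div, h₁, h₀, hne]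
  -- `θ` carries the places `≥ 1` of `χ / ψ`: thus `ψ * θ` agrees with `χ` on `G_{-1}` and with `ψ`
  -- in the places `≤ 0`.
  set θ := dualComp (tail p 1) (continuous_tail 1) (χ / ψ) with hθdef
  have e₁ : m₀ χ = m₀ (ψ * θ) := by
    refine he.const_on_cosets _ _ ?_
    rw [← div_div, mem_annihilator_iff]
    intro x hx
    rw [pair_dual_div, hθ x (by simpa using hx), hθdef, pair_dualComp, div_self]
    rw [← norm_ne_zero_iff, norm_pair]
    exact one_ne_zero
  -- The mask formula evaluates characters at `A⁻¹ h` with `h ∈ H₀`, which lives in places `≤ 0`,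
  -- where `θ` is trivial.
  rw [e₁, hβ, hβ]
  congr 1
  refine Finset.sum_congr rfl fun h hh => ?_
  rw [pair_dualDil, pair_dualDil, pair_dual_mul, hθdef, pair_dualComp, tail_eq_zero, pair_zero,
    mul_one]
  intro k hk
  exact (mem_H₀trunc.1 hh).1 _ (by omega)

end Mask

/-! ### Integration over balls and a Bessel inequality -/

section Analysis

theorem IsStep.continuous {M N : ℕ} {φ : VilenkinGroup p → ℂ} (h : IsStep M N φ) :
    Continuous φ := by
  refine (IsLocallyConstant.iff_exists_open φ).2 (fun x => ?_) |>.continuous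
  exact ⟨_, isOpen_coset x M, by simp [(ball p _).zero_mem], fun y hy => h.const_on_cosets y x hy⟩

variable [NeZero p]

instance : (haar p).IsAddHaarMeasure := by
  unfold haar
  infer_instance

/-- Translation by `g ∈ G_M` fixes `φ` but multiplies its transform by `conj (pair χ g)`. -/
theorem IsStep.mem_annihilator_of_fourier_ne_zero {M N : ℕ} {φ : VilenkinGroup p → ℂ}
    (h : IsStep M N φ) {χ : Dual p} (hχ : fourier φ χ ≠ 0) : χ ∈ annihilator p (M : ℤ) := by
  rw [mem_annihilator_iff]
  intro g hg
  have e : fourier φ χ = fourier φ χ * conj (pair χ g) := by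
    conv_lhs => rw [fourier, ← integral_add_right_eq_self _ g]
    rw [fourier, ← integral_mul_const]
    refine integral_congr_ae (Filter.Eventually.of_forall fun x => ?_)
    simp only [pair_add, map_mul]
    rw [h.const_on_cosets (x + g) x (by simpa using hg), mul_assoc]
  have e' : conj (pair χ g) = 1 := mul_left_cancel₀ hχ (by rw [← e, mul_one])
  simpa using congrArg conj e'

theorem continuous_integrableOn_ball {f : VilenkinGroup p → ℂ} (hf : Continuous f) (n : ℤ) :
    Integrable f ((haar p).restrict (ball p n)) :=
  hf.continuousOn.integrableOn_compact (isCompact_ball n)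

/-- Orthogonality of characters: translation by `g` preserves the integral and also multiplies it by
a factor other than `1`. -/
theorem setIntegral_ball_pair_mul_conj_of_ne {n : ℤ} {χ ψ : Dual p} {g : VilenkinGroup p}
    (hg : g ∈ ball p n) (hne : pair χ g ≠ pair ψ g) :
    ∫ x in ball p n, pair χ x * conj (pair ψ x) ∂(haar p) = 0 := by
  have hm : MeasurableSet (ball p n : Set (VilenkinGroup p)) := (isOpen_ball n).measurableSet
  set I := ∫ x in ball p n, pair χ x * conj (pair ψ x) ∂(haar p) with hI
  have e : I = (pair χ g * conj (pair ψ g)) * I := by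
    rw [hI, ← integral_const_mul, ← integral_indicator hm, ← integral_indicator hm,
      ← integral_add_right_eq_self _ g]
    congr 1
    funext x
    have hx : x + g ∈ (ball p n : Set (VilenkinGroup p)) ↔
        x ∈ (ball p n : Set (VilenkinGroup p)) := (ball p n).add_mem_cancel_right hg
    by_cases h : x ∈ (ball p n : Set (VilenkinGroup p))
    · rw [Set.indicator_of_mem (hx.2 h), Set.indicator_of_mem h]
      simp only [pair_add, map_mul]
      ring
    · rw [Set.indicator_of_notMem (mt hx.1 h), Set.indicator_of_notMem h]
  by_contra h0
  have e' : pair χ g * conj (pair ψ g) = 1 := mul_right_cancel₀ h0 (by rw [← e, one_mul])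
  apply hne
  calc pair χ g = pair χ g * conj (pair ψ g) * pair ψ g := by
        rw [mul_assoc, mul_comm (conj _), pair_mul_conj, mul_one]
    _ = pair ψ g := by rw [e', one_mul]

/-- The translates of `G_0` by `H_0^{(s)}` cover `G_{-s}`. Only this upper bound is needed in the
Bessel argument. -/
theorem haar_ball_le (s : ℕ) :
    (haar p).real (ball p (-(s : ℤ))) ≤ (H₀trunc p s).card := by
  have h0 : haar p (ball p 0 : Set (VilenkinGroup p)) = 1 :=
    Measure.addHaarMeasure_self (K₀ := unitBall p)
  have hsub : (ball p (-(s : ℤ)) : Set (VilenkinGroup p)) ⊆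
      ⋃ h ∈ H₀trunc p s, (fun x => -h + x) ⁻¹' (ball p 0 : Set (VilenkinGroup p)) := by
    intro x hx
    have htail : ∀ k < 0, (x - tail p 0 x) k = x k := fun k hk => by
      rw [sub_apply, tail_apply, if_pos hk, sub_zero]
    refine Set.mem_biUnion (x := x - tail p 0 x) (mem_H₀trunc.2 ⟨fun k hk => ?_, fun k hk => ?_⟩) ?_
    · rw [sub_apply, tail_apply, if_neg (by omega), sub_self]
    · rw [htail k (by omega), hx k hk]
    · simpa using tail_mem_ball 0 x
  have hle : haar p (ball p (-(s : ℤ)) : Set (VilenkinGroup p)) ≤ (H₀trunc p s).card := by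
    refine (measure_mono hsub).trans ((measure_biUnion_finset_le _ _).trans ?_)
    simp [measure_preimage_add, h0]
  exact ENNReal.toReal_le_of_le_ofReal (by positivity) (by simpa using hle)

/-- Two characters that agree on `H₀` but are distinct on `G_{-N}` cannot both be points where the
Fourier transform of a function with orthonormal shifts has modulus `1`. -/
theorem OrthonormalShifts.pair_eq_of_norm_fourier_eq_one {M N : ℕ} {φ : VilenkinGroup p → ℂ}
    (hφ : OrthonormalShifts φ) (hs : IsStep M N φ) {χ ψ : Dual p}
    (hH : ∀ h ∈ H₀ p, pair χ h = pair ψ h) (hχ : ‖fourier φ χ‖ = 1) (hψ : ‖fourier φ ψ‖ = 1)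
    {g : VilenkinGroup p} (hg : g ∈ ball p (-(N : ℤ))) : pair χ g = pair ψ g := by
  by_contra hne
  set B := ball p (-(N : ℤ)) with hB
  set K := (H₀trunc p N).card with hK
  have hcont := hs.continuous
  have hcont' : ∀ h, Continuous fun x => φ (x - h) := fun h =>
    hcont.comp (continuous_id.sub continuous_const)
  have hcχ := continuous_pair χ
  have hcψ := continuous_pair ψ
  have hK0 : (1 : ℝ) ≤ K := by
    have : 0 < K := Finset.card_pos.2 ⟨0, mem_H₀trunc.2 ⟨(H₀ p).zero_mem, (ball p _).zero_mem⟩⟩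
    exact_mod_cast this
  have hsupp : ∀ h ∈ H₀trunc p N, ∀ x ∉ (B : Set (VilenkinGroup p)), φ (x - h) = 0 := by
    intro h hh x hx
    by_contra h0
    apply hx
    have := B.add_mem (hs.support_subset h0) (mem_H₀trunc.1 hh).2
    simpa using this
  -- The sum of shifts twisted by `χ`: orthonormality gives `‖F‖² = K`, while its inner product on
  -- `B` with any character that equals `χ` on `H₀` is `K` times the value of `φ̂` there.
  let F : VilenkinGroup p → ℂ := fun x => ∑ h ∈ H₀trunc p N, pair χ h * φ (x - h)
  have hF : Continuous F := continuous_finsetSum _ fun h _ => continuous_const.mul (hcont' h)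
  have hFF : ∫ x in B, F x * conj (F x) ∂(haar p) = K := by
    have e : ∀ x, F x * conj (F x) = ∑ h ∈ H₀trunc p N, ∑ h' ∈ H₀trunc p N,
        (pair χ h * conj (pair χ h')) * (φ (x - h) * conj (φ (x - h'))) := by
      intro x
      simp only [F, map_sum, map_mul, Finset.sum_mul_sum]
      exact Finset.sum_congr rfl fun _ _ => Finset.sum_congr rfl fun _ _ => by ring
    have hint : ∀ h h', Integrable
        (fun x => (pair χ h * conj (pair χ h')) * (φ (x - h) * conj (φ (x - h'))))
        ((haar p).restrict B) := fun h h' => continuous_integrableOn_ball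
      (continuous_const.mul ((hcont' h).mul (Complex.continuous_conj.comp (hcont' h')))) _
    simp only [e]
    rw [integral_finsetSum _ fun h _ => integrable_finsetSum _ fun h' _ => hint h h']
    have : ∀ h ∈ H₀trunc p N, ∫ x in B, ∑ h' ∈ H₀trunc p N,
        (pair χ h * conj (pair χ h')) * (φ (x - h) * conj (φ (x - h'))) ∂(haar p) = 1 := by
      intro h hh
      rw [integral_finsetSum _ fun h' _ => hint h h', Finset.sum_eq_single_of_mem h hh]
      · rw [integral_const_mul, setIntegral_eq_integral_of_forall_compl_eq_zero,
          (hφ.2 h (mem_H₀trunc.1 hh).1 h (mem_H₀trunc.1 hh).1).1 rfl, pair_mul_conj, one_mul]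
        intro x hx
        rw [hsupp h hh x hx, zero_mul]
      · intro h' hh' hne'
        rw [integral_const_mul, setIntegral_eq_integral_of_forall_compl_eq_zero,
          (hφ.2 h (mem_H₀trunc.1 hh).1 h' (mem_H₀trunc.1 hh').1).2 hne'.symm, mul_zero]
        intro x hx
        rw [hsupp h hh x hx, zero_mul]
    rw [Finset.sum_congr rfl this]
    simp [hK]
  have hFω : ∀ ω : Dual p, (∀ h ∈ H₀ p, pair χ h = pair ω h) →
      ∫ x in B, F x * conj (pair ω x) ∂(haar p) = K * fourier φ ω := by
    intro ω hω
    have hcω := continuous_pair ω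
    have e : ∀ x, F x * conj (pair ω x) = ∑ h ∈ H₀trunc p N,
        pair χ h * (φ (x - h) * conj (pair ω x)) := by
      intro x
      simp only [F, Finset.sum_mul, mul_assoc]
    simp only [e]
    rw [integral_finsetSum]
    · have : ∀ h ∈ H₀trunc p N, ∫ x in B, pair χ h * (φ (x - h) * conj (pair ω x)) ∂(haar p) =
          fourier φ ω := by
        intro h hh
        rw [integral_const_mul, setIntegral_eq_integral_of_forall_compl_eq_zero
          (fun x hx => by rw [hsupp h hh x hx, zero_mul]), ← integral_add_right_eq_self _ h]
        simp only [add_sub_cancel_right, pair_add, map_mul, ← mul_assoc]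
        rw [integral_mul_const, hω h (mem_H₀trunc.1 hh).1, mul_left_comm, pair_mul_conj, mul_one,
          fourier]
      rw [Finset.sum_congr rfl this]
      simp [hK]
    · intro h _
      exact continuous_integrableOn_ball (continuous_const.mul
        ((hcont' h).mul (Complex.continuous_conj.comp hcω))) _
  set c := fourier φ χ with hc
  set d := fourier φ ψ with hd
  have hcc : c * conj c = 1 := by rw [Complex.mul_conj', hχ]; simp
  have hdd : d * conj d = 1 := by rw [Complex.mul_conj', hψ]; simp
  -- If `μ(B) = K`, this is the orthogonal projection of `F` onto the span of `χ` and `ψ`, with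
  -- `‖w‖² = 2K > ‖F‖²`. Expanding `‖F - w‖²` exposes the contradiction.
  let w : VilenkinGroup p → ℂ := fun x => c * pair χ x + d * pair ψ x
  have hw : Continuous w := (continuous_const.mul hcχ).add (continuous_const.mul hcψ)
  have hFw : ∫ x in B, F x * conj (w x) ∂(haar p) = 2 * K := by
    have e : ∀ x, F x * conj (w x) =
        conj c * (F x * conj (pair χ x)) + conj d * (F x * conj (pair ψ x)) := by
      intro x
      simp only [w, map_add, map_mul]
      ring
    simp only [e]
    rw [integral_add, integral_const_mul, integral_const_mul, hFω χ fun _ _ => rfl, hFω ψ hH]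
    · linear_combination (K : ℂ) * hcc + (K : ℂ) * hdd
    · exact continuous_integrableOn_ball
        (continuous_const.mul (hF.mul (Complex.continuous_conj.comp hcχ))) _
    · exact continuous_integrableOn_ball
        (continuous_const.mul (hF.mul (Complex.continuous_conj.comp hcψ))) _
  have hww : ∫ x in B, w x * conj (w x) ∂(haar p) = 2 * ((haar p).real B : ℂ) := by
    have e : ∀ x, w x * conj (w x) = 2 + (c * conj d * (pair χ x * conj (pair ψ x)) +
        d * conj c * (pair ψ x * conj (pair χ x))) := by
      intro x
      have h₁ := pair_mul_conj χ x
      have h₂ := pair_mul_conj ψ x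
      simp only [w, map_add, map_mul]
      linear_combination (c * conj c) * h₁ + (d * conj d) * h₂ + hcc + hdd
    have i₁ : Integrable (fun x => c * conj d * (pair χ x * conj (pair ψ x)))
        ((haar p).restrict B) := continuous_integrableOn_ball
      (continuous_const.mul (hcχ.mul (Complex.continuous_conj.comp hcψ))) _
    have i₂ : Integrable (fun x => d * conj c * (pair ψ x * conj (pair χ x)))
        ((haar p).restrict B) := continuous_integrableOn_ball
      (continuous_const.mul (hcψ.mul (Complex.continuous_conj.comp hcχ))) _
    simp only [e]
    have i₃ : Integrable (fun x => c * conj d * (pair χ x * conj (pair ψ x)) +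
        d * conj c * (pair ψ x * conj (pair χ x))) ((haar p).restrict B) := i₁.add i₂
    rw [integral_add (continuous_integrableOn_ball continuous_const _) i₃, integral_add i₁ i₂, integral_const_mul, integral_const_mul,
      setIntegral_ball_pair_mul_conj_of_ne hg hne,
      setIntegral_ball_pair_mul_conj_of_ne hg (Ne.symm hne), setIntegral_const]
    simp [mul_comm, hB]
  have key : ∫ x in B, (F x - w x) * conj (F x - w x) ∂(haar p) =
      K - 2 * K - 2 * K + 2 * ((haar p).real B : ℂ) := by
    have e : ∀ x, (F x - w x) * conj (F x - w x) =
        F x * conj (F x) - F x * conj (w x) - conj (F x * conj (w x)) + w x * conj (w x) := by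
      intro x
      simp only [map_sub, map_mul, Complex.conj_conj]
      ring
    have i₁ := continuous_integrableOn_ball (hF.mul (Complex.continuous_conj.comp hF)) (-(N : ℤ))
    have i₂ := continuous_integrableOn_ball (hF.mul (Complex.continuous_conj.comp hw)) (-(N : ℤ))
    have i₃ := continuous_integrableOn_ball (Complex.continuous_conj.comp
      (hF.mul (Complex.continuous_conj.comp hw))) (-(N : ℤ))
    have i₄ := continuous_integrableOn_ball (hw.mul (Complex.continuous_conj.comp hw)) (-(N : ℤ))
    simp only [e]
    have s₁ := integral_add ((i₁.sub i₂).sub i₃) i₄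
    have s₂ := integral_sub (i₁.sub i₂) i₃
    have s₃ := integral_sub i₁ i₂
    have s₄ : ∫ x in B, conj (F x * conj (w x)) ∂(haar p) = 2 * K := by
      rw [integral_conj, hFw, map_mul, Complex.conj_natCast, Complex.conj_ofNat]
    simp only [Function.comp_apply, Pi.sub_apply, Pi.mul_apply, ← hB] at s₁ s₂ s₃
    rw [s₁, s₂, s₃, s₄, hFF, hFw, hww]
  have hreal : ∫ x in B, (F x - w x) * conj (F x - w x) ∂(haar p) =
      ((∫ x in B, ‖F x - w x‖ ^ 2 ∂(haar p) : ℝ) : ℂ) := by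
    rw [← integral_complex_ofReal]
    simp only [Complex.mul_conj', Complex.ofReal_pow]
  have hpos : 0 ≤ ∫ x in B, ‖F x - w x‖ ^ 2 ∂(haar p) := integral_nonneg fun x => by positivity
  rw [hreal] at key
  have key' : ∫ x in B, ‖F x - w x‖ ^ 2 ∂(haar p) = K - 2 * K - 2 * K + 2 * (haar p).real B := by
    exact_mod_cast key
  have hV := haar_ball_le (p := p) N
  rw [← hB, ← hK] at hV
  -- `0 ≤ ‖F - w‖² = -3K + 2μ(B) ≤ -K < 0`.
  linarith

end Analysis

/-! ### Walks in the support of the Fourier transform -/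

section Refinable

/-- The moduli of the partial products stay in the closed set `{0, 1}`. -/
theorem norm_eq_zero_or_one_of_tendsto_prod {a : ℕ → ℂ} {l : ℂ}
    (ha : ∀ j, ‖a j‖ = 0 ∨ ‖a j‖ = 1)
    (hl : Tendsto (fun n => ∏ j ∈ Finset.range n, a j) atTop (𝓝 l)) : ‖l‖ = 0 ∨ ‖l‖ = 1 := by
  have hc : IsClosed ({0, 1} : Set ℝ) := (Set.toFinite _).isClosed
  refine hc.mem_of_tendsto hl.norm (Eventually.of_forall fun n => ?_)
  induction n with
  | zero => simp
  | succ n ih =>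
    rw [Finset.prod_range_succ, norm_mul]
    rcases ha n with h | h <;> simp only [h, mul_zero, mul_one]
    · exact Or.inl rfl
    · exact ih

variable [NeZero p] {N : ℕ} {φ : VilenkinGroup p → ℂ} {m₀ : Dual p → ℂ}

/-- Splitting off the first `i` factors leaves `φ̂(χ A^{-i})`: tails of a walk of nonzero weight
have nonzero weight. -/
theorem fourier_dualDil_ne_zero
    (hprod : ∀ χ, Tendsto (fun n : ℕ => ∏ j ∈ Finset.range n, m₀ (dualDil (-(j : ℤ)) χ))
      atTop (𝓝 (fourier φ χ)))
    {χ : Dual p} (hχ : fourier φ χ ≠ 0) (i : ℕ) : fourier φ (dualDil (-(i : ℤ)) χ) ≠ 0 := by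
  have h₁ := (tendsto_add_atTop_iff_nat i).2 (hprod χ)
  have h₂ := (hprod (dualDil (-(i : ℤ)) χ)).const_mul
    (∏ j ∈ Finset.range i, m₀ (dualDil (-(j : ℤ)) χ))
  have e : (fun n : ℕ => ∏ j ∈ Finset.range (n + i), m₀ (dualDil (-(j : ℤ)) χ)) =
      fun n : ℕ => (∏ j ∈ Finset.range i, m₀ (dualDil (-(j : ℤ)) χ)) *
        ∏ j ∈ Finset.range n, m₀ (dualDil (-(j : ℤ)) (dualDil (-(i : ℤ)) χ)) := by
    funext n
    rw [add_comm n i, Finset.prod_range_add]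
    congr 1
    refine Finset.prod_congr rfl fun j _ => ?_
    rw [dualDil_dualDil]
    congr 2
    push_cast
    ring
  rw [e] at h₁
  intro h0
  apply hχ
  rw [tendsto_nhds_unique h₁ h₂, h0, mul_zero]

/-- The factor with index `j ≥ 0` reads only the places `j - 1` and `j`. -/
theorem fourier_congr (hm : IsRefinableWithMask N φ m₀) (he : IsElementary 1 m₀)
    (hprod : ∀ χ, Tendsto (fun n : ℕ => ∏ j ∈ Finset.range n, m₀ (dualDil (-(j : ℤ)) χ))
      atTop (𝓝 (fourier φ χ)))
    {χ ψ : Dual p} (h : ∀ k ≥ (-1 : ℤ), pair χ (unit p k) = pair ψ (unit p k)) :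
    fourier φ χ = fourier φ ψ := by
  refine tendsto_nhds_unique (hprod χ) ?_
  convert hprod ψ using 3 with n j
  refine mask_congr hm he ?_ ?_
  · rw [pair_dualDil, pair_dualDil, dil_unit]
    exact h _ (by omega)
  · rw [pair_dualDil, pair_dualDil, dil_unit]
    exact h _ (by omega)

/-- Along a character in the support of the Fourier transform, no coordinate value recurs before
the coordinates become trivial for good. -/
theorem pair_unit_ne_of_lt {M : ℕ} (hs : IsStep M N φ) (hφ : OrthonormalShifts φ)
    (hm : IsRefinableWithMask N φ m₀) (he : IsElementary 1 m₀)
    (hprod : ∀ χ, Tendsto (fun n : ℕ => ∏ j ∈ Finset.range n, m₀ (dualDil (-(j : ℤ)) χ))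
      atTop (𝓝 (fourier φ χ)))
    {χ : Dual p} (hχ : fourier φ χ ≠ 0) {l : ℕ} (hl : χ ∈ annihilator p (l : ℤ))
    (hl' : pair χ (unit p (l - 1)) ≠ 1) {i j : ℕ} (hij : i < j) (hj : j ≤ l + 1) :
    pair χ (unit p (i - 1)) ≠ pair χ (unit p (j - 1)) := by
  intro heq
  -- The tail of the walk from step `k`. Erasing the places below `-1` leaves `φ̂` unchanged and
  -- makes the restriction to `H₀` depend only on the starting vertex.
  let ψ : ℕ → Dual p := fun k => dualComp (tail p (-1)) (continuous_tail _) (dualDil (-(k : ℤ)) χ)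
  have hψ : ∀ k : ℕ, ∀ n ≥ (-1 : ℤ), pair (ψ k) (unit p n) = pair χ (unit p (n + k)) := by
    intro k n hn
    rw [pair_dualComp, tail_eq_self (unit_mem_ball hn), pair_dualDil, dil_unit, sub_neg_eq_add]
  have hnorm : ∀ k, ‖fourier φ (ψ k)‖ = 1 := by
    intro k
    refine (norm_eq_zero_or_one_of_tendsto_prod (fun _ => he.norm_eq _) (hprod (ψ k))).resolve_left
      ?_
    rw [norm_eq_zero, fourier_congr hm he hprod (ψ := dualDil (-(k : ℤ)) χ)]
    · exact fourier_dualDil_ne_zero hprod hχ k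
    · intro n hn
      rw [hψ k n hn, pair_dualDil, dil_unit, sub_neg_eq_add]
  have hH : ∀ h ∈ H₀ p, pair (ψ i) h = pair (ψ j) h := by
    intro h hh
    have e : tail p (-1) h = (h (-1)).val • unit p (-1) := by
      ext k
      rw [tail_apply, nsmul_unit_apply]
      rcases lt_trichotomy k (-1) with hk | rfl | hk
      · rw [if_pos hk, if_neg hk.ne]
      · simp
      · rw [if_neg (by omega), if_neg hk.ne', hh k (by omega)]
    simp only [ψ, pair_dualComp, e, pair_nsmul, pair_dualDil, dil_unit]
    rw [show (-1 : ℤ) - -(i : ℤ) = i - 1 by ring, show (-1 : ℤ) - -(j : ℤ) = j - 1 by ring, heq]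
  -- Here `ψ i` reads place `l - 1` of `χ`, its last nontrivial coordinate, while `ψ j` reads a
  -- place `≥ l`.
  set g := unit p ((l : ℤ) - 1 - i) with hg
  rcases Nat.lt_or_ge i l with hil | hil
  · have hgB : g ∈ ball p (-(N : ℤ)) := unit_mem_ball (by omega)
    have h := hφ.pair_eq_of_norm_fourier_eq_one hs hH (hnorm i) (hnorm j) hgB
    rw [hg, hψ i _ (by omega), hψ j _ (by omega), sub_add_cancel,
      mem_annihilator_iff.1 hl (unit p (l - 1 - i + j)) (unit_mem_ball (by omega))] at h
    exact hl' h
  -- Now `g = unit p (-1)` need not lie in `G_{-N}`, but `j = l + 1` and the repetition directly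
  -- makes coordinate `l - 1` trivial.
  · obtain rfl : i = l := by omega
    rw [mem_annihilator_iff.1 hl (unit p (j - 1)) (unit_mem_ball (by omega))] at heq
    exact hl' heq

theorem tsupport_fourier_subset {M : ℕ} (hp : 2 ≤ p) (hstep : IsStep M N φ)
    (helem : IsElementaryRefinable 1 N φ) (hφ : OrthonormalShifts φ) :
    tsupport (fourier φ) ⊆ (annihilator p ((p : ℤ) - 2) : Set (Dual p)) := by
  classical
  refine closure_minimal (fun χ hχ => ?_) (isClosed_annihilator _)
  obtain ⟨m₀, hm, he, hprod⟩ := helem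
  have hex : ∃ n : ℕ, χ ∈ annihilator p (n : ℤ) :=
    ⟨M, hstep.mem_annihilator_of_fourier_ne_zero hχ⟩
  set l := Nat.find hex with hl
  have hlmem : χ ∈ annihilator p (l : ℤ) := Nat.find_spec hex
  by_contra hnot
  -- This also forces `l ≥ 1`, so minimality can be tested at the natural number `l - 1`.
  have hlp : p ≤ l + 1 := by
    by_contra! hlt
    exact hnot (annihilator_mono (by omega) hlmem)
  have hl' : pair χ (unit p (l - 1)) ≠ 1 := by
    intro h1
    have h := mem_annihilator_of_succ (n := (l : ℤ) - 1) (by simpa using hlmem) h1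
    refine Nat.find_min hex (m := l - 1) (by omega) ?_
    rwa [Nat.cast_sub (by omega), Nat.cast_one]
  -- Pigeonhole: the `l + 2 > p` places `-1, ..., l` take values among at most `p` roots of unity.
  obtain ⟨i, hi, j, hj, hij, heq⟩ := Finset.exists_ne_map_eq_of_card_lt_of_maps_to
    (s := Finset.range (l + 2)) (t := (Polynomial.nthRoots p (1 : ℂ)).toFinset)
    (f := fun j : ℕ => pair χ (unit p (j - 1)))
    (by
      have h₁ := (Polynomial.nthRoots p (1 : ℂ)).toFinset_card_le
      have h₂ := Polynomial.card_nthRoots p (1 : ℂ)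
      rw [Finset.card_range]
      omega)
    (fun j _ => by
      simp [Polynomial.mem_nthRoots (NeZero.pos p), pair_pow_card])
  rw [Finset.mem_range] at hi hj
  rcases lt_or_gt_of_ne hij with h | h
  · exact pair_unit_ne_of_lt hstep hφ hm he hprod hχ hlmem hl' h (by omega) heq
  · exact pair_unit_ne_of_lt hstep hφ hm he hprod hχ hlmem hl' h (by omega) heq.symm

end Refinable

end VilenkinGroup

theorem mainTheorem1 (p : ℕ) [NeZero p] (hp : 3 ≤ p) (M N : ℕ) (φ : VilenkinGroup p → ℂ)
    (hstep : VilenkinGroup.IsStep M N φ)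
    (helem : VilenkinGroup.IsElementaryRefinable 1 N φ)
    (hmra : VilenkinGroup.GeneratesMRA φ) :
    tsupport (VilenkinGroup.fourier φ) ⊆
      (VilenkinGroup.annihilator p ((p : ℤ) - 2) : Set (VilenkinGroup.Dual p)) :=
  VilenkinGroup.tsupport_fourier_subset (by omega) hstep helem hmra.1
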